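/- Let $\mathbb T^2=\mathbb R^2/\mathbb Z^2$. A homeomorphism $f$ of $\mathbb T^2$ that is orientation preserving and isotopic to the identity has Denjoy type if it is not topologically conjugate to a translation of $\mathbb T^2$ and there are a continuous map $h\colon\mathbb T^2\to\mathbb T^2$, homotopic to the identity, and a translation $R$ of $\mathbb T^2$ all of whose orbits are dense, such that $h\circ f=R\circ h$ and the set of points $p\in\mathbb T^2$ for which $h^{-1}(p)$ has more than one element is non-empty and countable. The wandering domains of $f$ are the non-empty sets among the interiors of the fibres $h^{-1}(p)$, $p\in\mathbb T^2$, and the minimal set of $f$ is the complement of the union of the wandering domains. A domain in $\mathbb T^2$ is called square if its lifts to $\mathbb R^2$ are non-degenerate geometric squares with sides parallel to the coordinate axes. Proposition. There is no Denjoy type $\mathcal C^1$-diffeomorphism $f$ of $\mathbb T^2$ that has at least one wandering domain and all of whose wandering domains are square. (No assumption is made on the measure of the minimal set of $f$.) -/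

import Mathlib

/-- The `n`-torus `ℝⁿ / ℤⁿ`, as the product of `n` copies of `ℝ / ℤ`. -/
abbrev Torus (n : ℕ) : Type := UnitAddTorus (Fin n)

/-- The covering projection `ℝⁿ → ℝⁿ / ℤⁿ`. -/
def torusProj (n : ℕ) (x : Fin n → ℝ) : Torus n := fun i => (x i : UnitAddCircle)

/-- A self-map of the flat torus is of class `C¹`: it has a lift to the universal cover `ℝⁿ` that is
of class `C¹`. (Every continuous self-map has a lift, and the covering projection is a local
diffeomorphism.) -/
def IsC1TorusMap {n : ℕ} (f : Torus n → Torus n) : Prop :=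
  ∃ F : (Fin n → ℝ) → (Fin n → ℝ), ContDiff ℝ 1 F ∧ ∀ x, torusProj n (F x) = f (torusProj n x)

/-- A homeomorphism of the torus is a `C¹`-diffeomorphism: it and its inverse are of class `C¹`. -/
def IsC1TorusDiffeo {n : ℕ} (f : Torus n ≃ₜ Torus n) : Prop :=
  IsC1TorusMap f ∧ IsC1TorusMap f.symm

/-- `f` is isotopic to the identity: the two are joined by a continuous path of homeomorphisms.
Such an `f` is orientation preserving. -/
def IsIsotopicToId {X : Type*} [TopologicalSpace X] (f : X ≃ₜ X) : Prop :=
  ∃ H : C(unitInterval × X, X), (∀ x, H (0, x) = x) ∧ (∀ x, H (1, x) = f x) ∧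
    ∀ t, IsHomeomorph fun x => H (t, x)

/-- The translation of the torus by `α` is minimal: each of its orbits is dense. -/
def IsMinimalTranslation {n : ℕ} (α : Torus n) : Prop :=
  ∀ x : Torus n, Dense (Set.range fun k : ℤ => x + k • α)

/-- `f` is topologically conjugate to a translation of the torus. -/
def IsConjToTranslation {n : ℕ} (f : Torus n ≃ₜ Torus n) : Prop :=
  ∃ (g : Torus n ≃ₜ Torus n) (β : Torus n), ∀ x, g (f x) = g x + β

/-- The set of non-trivial values of `h`: the points with more than one preimage. -/
def nontrivialValues {X Y : Type*} (h : X → Y) : Set Y :=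
  {p | (h ⁻¹' {p}).Nontrivial}

/-- `h` is a semiconjugacy as in the definition of a Denjoy type homeomorphism: a continuous map of
the torus, homotopic to the identity, whose set of non-trivial values is non-empty and countable,
and which semiconjugates `f` to a minimal translation. -/
structure IsDenjoySemiconj {n : ℕ} (f : Torus n ≃ₜ Torus n) (h : C(Torus n, Torus n)) : Prop where
  homotopic_id : h.Homotopic (ContinuousMap.id (Torus n))
  nonempty_values : (nontrivialValues h).Nonempty
  countable_values : (nontrivialValues h).Countable
  semiconj : ∃ α : Torus n, IsMinimalTranslation α ∧ ∀ x, h (f x) = h x + α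

/-- `f` has Denjoy type, as witnessed by the semiconjugacy `h`. -/
structure IsDenjoyTypeVia {n : ℕ} (f : Torus n ≃ₜ Torus n) (h : C(Torus n, Torus n)) : Prop where
  isotopic_id : IsIsotopicToId f
  denjoy_semiconj : IsDenjoySemiconj f h
  not_conj : ¬ IsConjToTranslation f

/-- The wandering domains: the non-empty interiors of the fibres of the semiconjugacy `h`. -/
def wanderingDomains {n : ℕ} (h : C(Torus n, Torus n)) : Set (Set (Torus n)) :=
  {D | D.Nonempty ∧ ∃ p, D = interior (h ⁻¹' {p})}

/-- The open square in `ℝ²` with sides parallel to the coordinate axes, lower left corner `a` and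
side length `s`. -/
def openSquare (a : Fin 2 → ℝ) (s : ℝ) : Set (Fin 2 → ℝ) :=
  Set.univ.pi fun i => Set.Ioo (a i) (a i + s)

/-- `D` is a domain in the 2-torus whose lifts to `ℝ²` are non-degenerate axis-parallel squares:
the covering projection maps some such open square bijectively onto `D`. (The connected components
of the preimage of `D` in `ℝ²` are then the integer translates of that square.) -/
def IsSquareDomain (D : Set (Torus 2)) : Prop :=
  ∃ (a : Fin 2 → ℝ) (s : ℝ), 0 < s ∧ Set.BijOn (torusProj 2) (openSquare a s) D

/-! Let `F` be a lift of `f`. It carries a square of side s over a wandering domain onto a square of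
side s' over the image domain. The target has width s' in each coordinate, so the fundamental
theorem of calculus on horizontal slices gives |∫ u| ≤ s s' for u = ∂₁Fᵢ, and the area formula gives
∫ J = s'² for J = |det DF|. Such squares shrink to every point outside the wandering domains
(`exists_lifted_square_subset_ball`), and comparing means yields u² ≤ J there
(`sq_le_of_openSquare_estimates`). This pointwise bound makes the measure of the minimal set
irrelevant.

Put w = 1 + J - 2σu with σ = ±1. Over a square its integral is at least s² + s'² - 2ss' = (s - s')²,
and outside the wandering domains w ≥ (1 - σu)². Over the unit cube ∫ J ≤ 1, and for a suitable i
equivariance makes ∫ u a non-zero integer, so some σ gives ∫ w ≤ 0. Every contribution then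
vanishes, hence s = s': areas of wandering domains are preserved
(`measureReal_image_wanderingDomain`). An orbit of wandering domains would be an infinite disjoint
family of equal positive area in a torus of area 1. -/

open scoped Pointwise

/-! ### The covering projection and its sheets -/

/-- The lattice `ℤⁿ` in `ℝⁿ`. -/
abbrev intLattice (n : ℕ) : Submodule ℤ (Fin n → ℝ) :=
  Submodule.span ℤ (Set.range (Pi.basisFun ℝ (Fin n)))

/-- The half-open unit cube in `ℝⁿ`, a fundamental domain of `intLattice n`. -/
abbrev unitCube (n : ℕ) : Set (Fin n → ℝ) :=
  ZSpan.fundamentalDomain (Pi.basisFun ℝ (Fin n))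

theorem mem_intLattice_iff {n : ℕ} {x : Fin n → ℝ} :
    x ∈ intLattice n ↔ ∀ i, ∃ m : ℤ, (m : ℝ) = x i := by
  rw [Module.Basis.mem_span_iff_repr_mem]
  simp

theorem torusProj_eq_iff {n : ℕ} {x y : Fin n → ℝ} :
    torusProj n x = torusProj n y ↔ x - y ∈ intLattice n := by
  rw [mem_intLattice_iff, funext_iff]
  refine forall_congr' fun i => ?_
  rw [torusProj, torusProj, ← sub_eq_zero, ← AddCircle.coe_sub, AddCircle.coe_eq_zero_iff]
  simp

theorem torusProj_vadd {n : ℕ} (k : intLattice n) (x : Fin n → ℝ) :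
    torusProj n (k +ᵥ x) = torusProj n x := by
  rw [torusProj_eq_iff]
  simp [Submodule.vadd_def]

theorem continuous_torusProj (n : ℕ) : Continuous (torusProj n) :=
  continuous_pi fun i => (AddCircle.continuous_mk' 1).comp (continuous_apply i)

theorem torusProj_surjective (n : ℕ) : Function.Surjective (torusProj n) := fun p => by
  choose x hx using fun i => QuotientAddGroup.mk_surjective (p i)
  exact ⟨x, funext hx⟩

theorem preimage_image_torusProj {n : ℕ} (A : Set (Fin n → ℝ)) :
    torusProj n ⁻¹' (torusProj n '' A) = ⋃ k : intLattice n, k +ᵥ A := by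
  ext x
  simp only [Set.mem_preimage, Set.mem_image, Set.mem_iUnion]
  constructor
  · rintro ⟨y, hy, hyx⟩
    exact ⟨⟨x - y, torusProj_eq_iff.1 hyx.symm⟩, y, hy, by simp⟩
  · rintro ⟨k, y, hy, rfl⟩
    exact ⟨y, hy, (torusProj_vadd k y).symm⟩

theorem isOpen_lattice_vadd {n : ℕ} {A : Set (Fin n → ℝ)} (hA : IsOpen A) (k : intLattice n) :
    IsOpen (k +ᵥ A) :=
  (Homeomorph.addLeft (k : Fin n → ℝ)).isOpenMap A hA

theorem isOpenMap_torusProj (n : ℕ) : IsOpenMap (torusProj n) := by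
  have hcar : IsOpenMap fun t : ℝ => (t : UnitAddCircle) := QuotientAddGroup.isOpenMap_coe
  exact IsOpenMap.piMap (fun _ => hcar)
    (Filter.Eventually.of_forall fun _ => QuotientAddGroup.mk_surjective)

/-- Over a set that `torusProj` embeds, a connected set lies in a single sheet. -/
theorem exists_subset_lattice_vadd {n : ℕ} {S B : Set (Fin n → ℝ)} (hS : IsPreconnected S)
    (hne : S.Nonempty) (hB : IsOpen B) (hinj : Set.InjOn (torusProj n) B)
    (hSB : torusProj n '' S ⊆ torusProj n '' B) : ∃ k : intLattice n, S ⊆ k +ᵥ B := by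
  have hcov : S ⊆ ⋃ k : intLattice n, k +ᵥ B := by
    rw [← preimage_image_torusProj]
    exact Set.image_subset_iff.1 hSB
  obtain ⟨x, hx⟩ := hne
  obtain ⟨k, hk⟩ := Set.mem_iUnion.1 (hcov hx)
  refine ⟨k, hS.subset_left_of_subset_union (v := ⋃ (l : intLattice n) (_ : l ≠ k), l +ᵥ B)
    (isOpen_lattice_vadd hB k)
    (isOpen_iUnion fun l => isOpen_iUnion fun _ => isOpen_lattice_vadd hB l) ?_ ?_ ⟨x, hx, hk⟩⟩
  · rw [Set.disjoint_left]
    rintro _ ⟨y, hy, rfl⟩ h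
    simp only [Set.mem_iUnion] at h
    obtain ⟨l, hl, z, hz, hzy⟩ := h
    have hyz : z = y := hinj hz hy (by
      rw [← torusProj_vadd l z, ← torusProj_vadd k y]
      exact congrArg _ hzy)
    subst hyz
    exact hl (Subtype.ext (add_right_cancel (b := z) hzy))
  · intro y hy
    obtain ⟨l, hl⟩ := Set.mem_iUnion.1 (hcov hy)
    by_cases hlk : l = k
    · exact Or.inl (hlk ▸ hl)
    · exact Or.inr (Set.mem_iUnion₂.2 ⟨l, hlk, hl⟩)

/-- A continuous map into the integer lattice is constant. -/
theorem eq_of_continuous_of_mem_intLattice {n m : ℕ} {g : (Fin n → ℝ) → (Fin m → ℝ)}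
    (hg : Continuous g) (hmem : ∀ x, g x ∈ intLattice m) (x y : Fin n → ℝ) : g x = g y :=
  congrArg Subtype.val (PreconnectedSpace.constant (Y := intLattice m) inferInstance
    (f := fun x => ⟨g x, hmem x⟩) (hg.subtype_mk hmem) (x := x) (y := y))

/-! ### Integration over fundamental domains -/

/-- Applied with P the full preimage of a domain of the torus: for the restricted measure, a lift of
that domain is itself a fundamental domain. -/
theorem vaddInvariantMeasure_restrict {G α : Type*} [AddGroup G] [AddAction G α]
    [MeasurableSpace α] [MeasurableConstVAdd G α] {μ : MeasureTheory.Measure α}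
    [MeasureTheory.VAddInvariantMeasure G α μ] {P : Set α} (hP : ∀ (g : G) x, g +ᵥ x ∈ P ↔ x ∈ P) :
    MeasureTheory.VAddInvariantMeasure G α (μ.restrict P) where
  measure_preimage_vadd g s hs := by
    have hm : Measurable fun x : α => g +ᵥ x := measurable_const_vadd g
    rw [MeasureTheory.Measure.restrict_apply (hm hs), MeasureTheory.Measure.restrict_apply hs,
      ← MeasureTheory.measure_preimage_vadd μ g (s ∩ P)]
    congr 1
    ext x
    simp [hP g x]

instance intLattice.vaddInvariantMeasure (n : ℕ) : MeasureTheory.VAddInvariantMeasure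
    (intLattice n) (Fin n → ℝ) MeasureTheory.volume where
  measure_preimage_vadd k s _ := MeasureTheory.measure_preimage_add _ (k : Fin n → ℝ) s

open MeasureTheory in
/-- A function on the torus has the same integral over a domain in the torus and over a lift
of that domain. -/
theorem setIntegral_unitCube_inter_preimage {n : ℕ} {A : Set (Fin n → ℝ)} {D : Set (Torus n)}
    (hA : IsOpen A) (hAD : Set.BijOn (torusProj n) A D) {w : (Fin n → ℝ) → ℝ}
    (hw : ∀ (k : intLattice n) x, w (k +ᵥ x) = w x) :
    ∫ x in unitCube n ∩ torusProj n ⁻¹' D, w x = ∫ x in A, w x := by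
  rw [← hAD.image_eq]
  set P := torusProj n ⁻¹' (torusProj n '' A) with hPdef
  have hP : MeasurableSet P :=
    (((isOpenMap_torusProj n) A hA).preimage (continuous_torusProj n)).measurableSet
  have hPinv : ∀ (k : intLattice n) x, k +ᵥ x ∈ P ↔ x ∈ P := fun k x => by
    simp only [hPdef, Set.mem_preimage, torusProj_vadd]
  have := vaddInvariantMeasure_restrict (μ := (volume : Measure (Fin n → ℝ))) hPinv
  have hCfd := ZSpan.isAddFundamentalDomain (Pi.basisFun ℝ (Fin n))
    ((volume : Measure (Fin n → ℝ)).restrict P)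
  have hAfd : IsAddFundamentalDomain (intLattice n) A
      ((volume : Measure (Fin n → ℝ)).restrict P) := by
    refine ⟨hA.measurableSet.nullMeasurableSet, ?_, fun k l hkl => Disjoint.aedisjoint ?_⟩
    · filter_upwards [ae_restrict_mem hP] with x hx
      obtain ⟨y, hy, hyx⟩ := hx
      exact ⟨⟨y - x, torusProj_eq_iff.1 hyx⟩, by simpa [Submodule.vadd_def] using hy⟩
    · rw [Set.disjoint_left]
      rintro _ ⟨y, hy, rfl⟩ ⟨z, hz, hzy⟩
      have hyz : z = y := hAD.injOn hz hy (by
        rw [← torusProj_vadd l z, ← torusProj_vadd k y]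
        exact congrArg _ hzy)
      subst hyz
      exact hkl (Subtype.ext (add_right_cancel (b := z) hzy)).symm
  have h := hCfd.setIntegral_eq hAfd (f := w) hw
  rw [Measure.restrict_restrict hA.measurableSet,
    Measure.restrict_restrict (ZSpan.fundamentalDomain_measurableSet _)] at h
  rwa [Set.inter_eq_self_of_subset_left (Set.subset_preimage_image _ A)] at h

/-! ### Calculus and geometry of axis-parallel squares -/

open MeasureTheory in
theorem setIntegral_Icc_fderiv_single_zero {φ : (Fin 2 → ℝ) → ℝ} (hφ : ContDiff ℝ 1 φ)
    (a : Fin 2 → ℝ) {s : ℝ} (hs : 0 ≤ s) :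
    ∫ x in Set.Icc a (fun i => a i + s), fderiv ℝ φ x (Pi.single 0 1) =
      ∫ c in (a 1)..(a 1 + s), (φ ![a 0 + s, c] - φ ![a 0, c]) := by
  have hcont : Continuous fun x => fderiv ℝ φ x (Pi.single 0 1) :=
    (hφ.continuous_fderiv one_ne_zero).clm_apply continuous_const
  have hpair : Continuous fun p : ℝ × ℝ => (![p.1, p.2] : Fin 2 → ℝ) := by fun_prop
  have hpre : Set.Icc a (fun i => a i + s) = MeasurableEquiv.finTwoArrow ⁻¹'
      (Set.Icc (a 0) (a 0 + s) ×ˢ Set.Icc (a 1) (a 1 + s)) := by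
    ext x
    simp [Set.mem_Icc, Pi.le_def, Fin.forall_fin_two, MeasurableEquiv.finTwoArrow]
  have hfun : ∀ x : Fin 2 → ℝ, fderiv ℝ φ x (Pi.single 0 1) =
      (fun p : ℝ × ℝ => fderiv ℝ φ ![p.1, p.2] (Pi.single 0 1))
        (MeasurableEquiv.finTwoArrow x) := fun x => by
    have hx : x = ![x 0, x 1] := by
      ext i
      fin_cases i <;> rfl
    exact congrArg (fun y => fderiv ℝ φ y (Pi.single 0 1)) hx
  rw [setIntegral_congr_fun measurableSet_Icc fun x _ => hfun x, hpre,
    (volume_preserving_finTwoArrow ℝ).setIntegral_preimage_emb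
    (MeasurableEquiv.measurableEmbedding _)
    (fun p : ℝ × ℝ => fderiv ℝ φ ![p.1, p.2] (Pi.single 0 1)),
    -- The swap makes the first coordinate the inner variable, where the fundamental theorem of
    -- calculus applies.
    Measure.volume_eq_prod, ← setIntegral_prod_swap, setIntegral_prod,
    integral_Icc_eq_integral_Ioc, ← intervalIntegral.integral_of_le (by linarith)]
  · refine intervalIntegral.integral_congr fun c _ => ?_
    simp only [Prod.swap_prod_mk]
    rw [integral_Icc_eq_integral_Ioc, ← intervalIntegral.integral_of_le (by linarith)]
    refine intervalIntegral.integral_eq_sub_of_hasDerivAt (f := fun t => φ ![t, c])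
      (fun t _ => ?_) (Continuous.intervalIntegrable
        (hcont.comp (by fun_prop : Continuous fun t : ℝ => (![t, c] : Fin 2 → ℝ))) _ _)
    have hline : HasDerivAt (fun t : ℝ => (![t, c] : Fin 2 → ℝ)) (Pi.single 0 1) t := by
      rw [hasDerivAt_pi]
      intro i
      fin_cases i
      · simpa using! hasDerivAt_id t
      · simpa using hasDerivAt_const t c
    exact ((hφ.differentiable one_ne_zero) _).hasFDerivAt.comp_hasDerivAt t hline
  · exact ((hcont.comp (hpair.comp continuous_swap)).continuousOn).integrableOn_compact
      (isCompact_Icc.prod isCompact_Icc)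

theorem isOpen_openSquare (a : Fin 2 → ℝ) (s : ℝ) : IsOpen (openSquare a s) :=
  isOpen_set_pi Set.finite_univ fun _ _ => isOpen_Ioo

theorem convex_openSquare (a : Fin 2 → ℝ) (s : ℝ) : Convex ℝ (openSquare a s) :=
  convex_pi fun _ _ => convex_Ioo _ _

theorem nonempty_openSquare (a : Fin 2 → ℝ) {s : ℝ} (hs : 0 < s) : (openSquare a s).Nonempty :=
  Set.univ_pi_nonempty_iff.2 fun i => Set.nonempty_Ioo.2 (by linarith)

theorem openSquare_ae_eq_Icc (a : Fin 2 → ℝ) (s : ℝ) :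
    openSquare a s =ᵐ[MeasureTheory.volume] Set.Icc a (fun i => a i + s) :=
  MeasureTheory.Measure.univ_pi_Ioo_ae_eq_Icc

theorem unitCube_ae_eq_Icc :
    unitCube 2 =ᵐ[MeasureTheory.volume]
      Set.Icc (0 : Fin 2 → ℝ) (fun i => (0 : Fin 2 → ℝ) i + 1) := by
  rw [unitCube, ZSpan.fundamentalDomain_pi_basisFun]
  simpa using! MeasureTheory.Measure.univ_pi_Ico_ae_eq_Icc
    (μ := fun _ : Fin 2 => MeasureTheory.volume) (f := fun _ => (0 : ℝ)) (g := fun _ => (1 : ℝ))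

theorem closure_openSquare (a : Fin 2 → ℝ) {s : ℝ} (hs : 0 < s) :
    closure (openSquare a s) = Set.Icc a (fun i => a i + s) := by
  rw [openSquare, closure_pi_set, ← Set.pi_univ_Icc]
  exact congrArg _ (funext fun i => closure_Ioo (by linarith))

theorem volume_openSquare (a : Fin 2 → ℝ) {s : ℝ} (hs : 0 ≤ s) :
    MeasureTheory.volume.real (openSquare a s) = s ^ 2 := by
  rw [MeasureTheory.measureReal_def, openSquare, Real.volume_pi_Ioo]
  simp [ENNReal.toReal_ofReal hs]

open MeasureTheory in
-- Each horizontal slice contributes a difference of boundary values of `φ`, at most t once the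
-- oscillation bound is passed to the closure; the slices fill a height s.
theorem abs_setIntegral_openSquare_fderiv_le {φ : (Fin 2 → ℝ) → ℝ} (hφ : ContDiff ℝ 1 φ)
    {a : Fin 2 → ℝ} {s t : ℝ} (hs : 0 < s)
    (hosc : ∀ x ∈ openSquare a s, ∀ y ∈ openSquare a s, |φ x - φ y| ≤ t) :
    |∫ x in openSquare a s, fderiv ℝ φ x (Pi.single 0 1)| ≤ s * t := by
  have hcl : ∀ x ∈ Set.Icc a (fun i => a i + s), ∀ y ∈ Set.Icc a (fun i => a i + s),
      |φ x - φ y| ≤ t := by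
    intro x hx y hy
    rw [← closure_openSquare a hs] at hx hy
    have hxy : (x, y) ∈ closure (openSquare a s ×ˢ openSquare a s) := by
      rw [closure_prod_eq]
      exact ⟨hx, hy⟩
    exact closure_minimal (t := {p : (Fin 2 → ℝ) × (Fin 2 → ℝ) | |φ p.1 - φ p.2| ≤ t})
      (fun p hp => hosc _ hp.1 _ hp.2)
      (isClosed_le (((hφ.continuous.comp continuous_fst).sub
        (hφ.continuous.comp continuous_snd)).abs) continuous_const) hxy
  rw [setIntegral_congr_set (openSquare_ae_eq_Icc a s),
    setIntegral_Icc_fderiv_single_zero hφ a hs.le]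
  have h := intervalIntegral.norm_integral_le_of_norm_le_const (a := a 1) (b := a 1 + s) (C := t)
    (f := fun c => φ ![a 0 + s, c] - φ ![a 0, c]) (fun c hc => by
      rw [Set.uIoc_of_le (by linarith)] at hc
      refine hcl _ ?_ _ ?_ <;>
        simp [Set.mem_Icc, Pi.le_def, Fin.forall_fin_two, hc.1.le, hc.2, hs.le])
  rw [Real.norm_eq_abs, add_sub_cancel_left, abs_of_pos hs] at h
  linarith

open MeasureTheory in
theorem setIntegral_unitCube_fderiv {φ : (Fin 2 → ℝ) → ℝ} (hφ : ContDiff ℝ 1 φ) {m : ℝ}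
    (hm : ∀ x, φ (Pi.single 0 1 + x) = m + φ x) :
    ∫ x in unitCube 2, fderiv ℝ φ x (Pi.single 0 1) = m := by
  rw [setIntegral_congr_set unitCube_ae_eq_Icc, setIntegral_Icc_fderiv_single_zero hφ 0 zero_le_one]
  have h : ∀ c : ℝ, φ ![(0 : Fin 2 → ℝ) 0 + 1, c] - φ ![(0 : Fin 2 → ℝ) 0, c] = m := fun c => by
    have hc : (Pi.single 0 1 + ![0, c] : Fin 2 → ℝ) = ![(0 : Fin 2 → ℝ) 0 + 1, c] := by
      ext i
      fin_cases i <;> simp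
    rw [← hc, hm, Pi.zero_apply, add_sub_cancel_right]
  simp_rw [h]
  simp

theorem lattice_vadd_openSquare (k : intLattice 2) (a : Fin 2 → ℝ) (s : ℝ) :
    k +ᵥ openSquare a s = openSquare (k +ᵥ a) s := by
  ext x
  simp only [Set.mem_vadd_set_iff_neg_vadd_mem, openSquare, Set.mem_univ_pi, Submodule.vadd_def,
    Set.mem_Ioo, vadd_eq_add, Pi.add_apply, Pi.neg_apply]
  refine forall_congr' fun i => ⟨fun h => ⟨?_, ?_⟩, fun h => ⟨?_, ?_⟩⟩ <;> linarith [h.1, h.2]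

theorem bijOn_torusProj_lattice_vadd {n : ℕ} {A : Set (Fin n → ℝ)} {D : Set (Torus n)}
    (h : Set.BijOn (torusProj n) A D) (k : intLattice n) :
    Set.BijOn (torusProj n) (k +ᵥ A) D := by
  refine ⟨?_, ?_, ?_⟩
  · rintro _ ⟨x, hx, rfl⟩
    exact (torusProj_vadd k x).symm ▸ h.mapsTo hx
  · rintro _ ⟨x, hx, rfl⟩ _ ⟨y, hy, rfl⟩ hxy
    have hxy' : torusProj n x = torusProj n y := by
      rw [← torusProj_vadd k x, ← torusProj_vadd k y]
      exact hxy
    rw [h.injOn hx hy hxy']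
  · intro p hp
    obtain ⟨x, hx, rfl⟩ := h.surjOn hp
    exact ⟨k +ᵥ x, ⟨x, hx, rfl⟩, torusProj_vadd k x⟩

/-! ### Lifts of torus diffeomorphisms -/

/-- `F` is an injective `C¹` lift of the torus homeomorphism `f`. -/
structure IsC1InjectiveLift {n : ℕ} (f : Torus n ≃ₜ Torus n)
    (F : (Fin n → ℝ) → (Fin n → ℝ)) : Prop where
  contDiff : ContDiff ℝ 1 F
  torusProj_eq : ∀ x, torusProj n (F x) = f (torusProj n x)
  injective : Function.Injective F
  exists_vadd : ∀ k : intLattice n, ∃ m : intLattice n, ∀ x, F (k +ᵥ x) = m +ᵥ F x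

theorem IsC1TorusDiffeo.exists_lift {n : ℕ} {f : Torus n ≃ₜ Torus n} (hf : IsC1TorusDiffeo f) :
    ∃ F, IsC1InjectiveLift f F := by
  obtain ⟨⟨F, hF, hFf⟩, ⟨G, hG, hGf⟩⟩ := hf
  refine ⟨F, hF, hFf, fun x y hxy => ?_, fun k => ?_⟩
  -- The composite of the two lifts covers the identity, so it is a translation.
  · have h := eq_of_continuous_of_mem_intLattice (g := fun x => G (F x) - x)
      ((hG.continuous.comp hF.continuous).sub continuous_id)
      (fun x => torusProj_eq_iff.1 (by rw [hGf, hFf, f.symm_apply_apply])) x y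
    simpa [hxy] using h
  · have hmem : ∀ x, F (k +ᵥ x) - F x ∈ intLattice n := fun x =>
      torusProj_eq_iff.1 (by rw [hFf, hFf, torusProj_vadd])
    have hcont : Continuous fun x => F (k +ᵥ x) - F x :=
      (hF.continuous.comp (continuous_const.add continuous_id)).sub hF.continuous
    refine ⟨⟨_, hmem 0⟩, fun x => ?_⟩
    rw [Submodule.vadd_def, vadd_eq_add]
    exact sub_eq_iff_eq_add.1 (eq_of_continuous_of_mem_intLattice hcont hmem x 0)

namespace IsC1InjectiveLift

variable {n : ℕ} {f : Torus n ≃ₜ Torus n} {F : (Fin n → ℝ) → (Fin n → ℝ)}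

theorem fderiv_vadd (hF : IsC1InjectiveLift f F) (k : intLattice n) (x : Fin n → ℝ) :
    fderiv ℝ F (k +ᵥ x) = fderiv ℝ F x := by
  obtain ⟨m, hm⟩ := hF.exists_vadd k
  have h : (fun y => F ((k : Fin n → ℝ) + y)) = fun y => (m : Fin n → ℝ) + F y := funext hm
  have h' := congrArg (fun g => fderiv ℝ g x) h
  rw [fderiv_comp_add_left, fderiv_const_add] at h'
  exact h'

theorem fderiv_apply (hF : IsC1InjectiveLift f F) (i : Fin n) (x v : Fin n → ℝ) :
    fderiv ℝ (fun y => F y i) x v = fderiv ℝ F x v i := by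
  rw [((hasFDerivAt_pi'.1 (hF.contDiff.differentiable one_ne_zero x).hasFDerivAt) i).fderiv]
  rfl

theorem continuous_abs_det (hF : IsC1InjectiveLift f F) :
    Continuous fun x => |(fderiv ℝ F x).det| :=
  (ContinuousLinearMap.continuous_det.comp (hF.contDiff.continuous_fderiv one_ne_zero)).abs

theorem setIntegral_abs_det (hF : IsC1InjectiveLift f F) {A : Set (Fin n → ℝ)}
    (hA : MeasurableSet A) :
    ∫ x in A, |(fderiv ℝ F x).det| = MeasureTheory.volume.real (F '' A) := by
  have h := MeasureTheory.integral_image_eq_integral_abs_det_fderiv_smul MeasureTheory.volume hA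
    (fun x _ => (hF.contDiff.differentiable one_ne_zero x).hasFDerivAt.hasFDerivWithinAt)
    hF.injective.injOn fun _ => (1 : ℝ)
  simpa using h.symm

/-- By the area formula the integral is the volume of the image of the cube. Were it above 1,
Blichfeldt's principle would give two image points differing by a non-zero lattice vector, against
injectivity of `f` on the torus. -/
theorem setIntegral_unitCube_abs_det_le (hF : IsC1InjectiveLift f F) :
    ∫ x in unitCube n, |(fderiv ℝ F x).det| ≤ 1 := by
  have hC : MeasurableSet (unitCube n) := ZSpan.fundamentalDomain_measurableSet _
  have hvol : MeasureTheory.volume (unitCube n) = 1 := by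
    simp [ZSpan.fundamentalDomain_pi_basisFun, Real.volume_pi_Ico]
  rw [hF.setIntegral_abs_det hC, MeasureTheory.measureReal_def]
  refine ENNReal.toReal_le_of_le_ofReal zero_le_one ?_
  rw [ENNReal.ofReal_one, ← hvol]
  by_contra! hlt
  obtain ⟨_, ⟨x, hx, rfl⟩, _, ⟨y, hy, rfl⟩, k, hk, hkxy⟩ :=
    (ZSpan.isAddFundamentalDomain (Pi.basisFun ℝ (Fin n))
      MeasureTheory.volume).exists_ne_zero_vadd_eq
      (hC.image_of_continuousOn_injOn hF.contDiff.continuous.continuousOn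
        hF.injective.injOn).nullMeasurableSet hlt
  have hproj : torusProj n y = torusProj n x := f.injective (by
    rw [← hF.torusProj_eq, ← hF.torusProj_eq, ← hkxy]
    exact torusProj_vadd k (F x))
  have hxy : x = y := by
    rw [← ZSpan.fract_eq_self.2 hx, ← ZSpan.fract_eq_self.2 hy, ZSpan.fract_eq_fract,
      neg_add_eq_sub]
    exact torusProj_eq_iff.1 hproj
  subst hxy
  exact hk (Subtype.ext (add_eq_right.1 hkxy))

/-- The image of the square is connected, so it lies in one sheet over `f '' D`. It also projects
onto `f '' D`, hence fills that sheet. -/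
theorem image_openSquare {f : Torus 2 ≃ₜ Torus 2} {F : (Fin 2 → ℝ) → (Fin 2 → ℝ)}
    (hF : IsC1InjectiveLift f F) {D : Set (Torus 2)} {a a' : Fin 2 → ℝ} {s s' : ℝ} (hs : 0 < s)
    (hD : Set.BijOn (torusProj 2) (openSquare a s) D)
    (hD' : Set.BijOn (torusProj 2) (openSquare a' s') (f '' D)) :
    ∃ b, F '' openSquare a s = openSquare b s' := by
  have himg : torusProj 2 '' (F '' openSquare a s) = f '' D := by
    rw [← hD.image_eq, Set.image_image, Set.image_image]
    exact Set.image_congr fun x _ => hF.torusProj_eq x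
  obtain ⟨k, hk⟩ := exists_subset_lattice_vadd
    ((convex_openSquare a s).isPreconnected.image F hF.contDiff.continuous.continuousOn)
    ((nonempty_openSquare a hs).image F) (isOpen_openSquare a' s') hD'.injOn
    (by rw [himg, hD'.image_eq])
  refine ⟨k +ᵥ a', ?_⟩
  rw [lattice_vadd_openSquare] at hk
  have hbij := bijOn_torusProj_lattice_vadd hD' k
  rw [lattice_vadd_openSquare] at hbij
  refine hk.antisymm fun y hy => ?_
  obtain ⟨z, hz, hzy⟩ := himg.symm ▸ hbij.mapsTo hy
  rwa [← hbij.injOn (hk hz) hy hzy]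

end IsC1InjectiveLift

/-! ### Dynamics of the wandering domains -/

section Wandering

variable {n : ℕ} {f : Torus n ≃ₜ Torus n} {h : C(Torus n, Torus n)} {α : Torus n}

theorem image_fibre_of_semiconj (hα : ∀ x, h (f x) = h x + α) (p : Torus n) :
    f '' (h ⁻¹' {p}) = h ⁻¹' {p + α} := by
  ext x
  constructor
  · rintro ⟨y, rfl, rfl⟩
    exact hα y
  · intro hx
    refine ⟨f.symm x, ?_, f.apply_symm_apply x⟩
    have := hα (f.symm x)
    rw [f.apply_symm_apply, Set.mem_singleton_iff.1 hx] at this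
    exact (add_right_cancel this).symm

theorem image_interior_fibre_of_semiconj (hα : ∀ x, h (f x) = h x + α) (p : Torus n) :
    f '' interior (h ⁻¹' {p}) = interior (h ⁻¹' {p + α}) := by
  rw [f.image_interior, image_fibre_of_semiconj hα]

theorem image_mem_wanderingDomains (hα : ∀ x, h (f x) = h x + α) {D : Set (Torus n)}
    (hD : D ∈ wanderingDomains h) : f '' D ∈ wanderingDomains h := by
  obtain ⟨hne, p, rfl⟩ := hD
  exact ⟨hne.image f, _, image_interior_fibre_of_semiconj hα p⟩

theorem nonempty_interior_fibre_add_zsmul (hα : ∀ x, h (f x) = h x + α) {p : Torus n}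
    (hp : (interior (h ⁻¹' {p})).Nonempty) (k : ℤ) :
    (interior (h ⁻¹' {p + k • α})).Nonempty := by
  induction k using Int.induction_on with
  | zero => simpa using hp
  | succ k ih =>
    rw [add_zsmul, one_zsmul, ← add_assoc, ← image_interior_fibre_of_semiconj hα]
    exact ih.image f
  | pred k ih =>
    rw [← sub_add_cancel (p + (-(k : ℤ)) • α) α, ← image_interior_fibre_of_semiconj hα,
      Set.image_nonempty] at ih
    rwa [sub_zsmul, one_zsmul, ← sub_eq_add_neg, ← add_sub_assoc]

theorem isOpen_of_mem_wanderingDomains {D : Set (Torus n)} (hD : D ∈ wanderingDomains h) :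
    IsOpen D := by
  obtain ⟨-, p, rfl⟩ := hD
  exact isOpen_interior

theorem pairwiseDisjoint_wanderingDomains (h : C(Torus n, Torus n)) :
    (wanderingDomains h).PairwiseDisjoint id := by
  rintro _ ⟨-, p, rfl⟩ _ ⟨-, q, rfl⟩ hpq
  refine Disjoint.mono interior_subset interior_subset ?_
  refine Disjoint.preimage h (Set.disjoint_singleton.2 ?_)
  rintro rfl
  exact hpq rfl

/-- Wandering domains accumulate at every point whose fibre is trivial. -/
theorem exists_wanderingDomain_subset (hα : ∀ x, h (f x) = h x + α) (hmin : IsMinimalTranslation α)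
    (hne : (wanderingDomains h).Nonempty) {U : Set (Torus n)} (hU : IsOpen U)
    {y : Torus n} (hy : y ∈ U) (hfib : h y ∉ nontrivialValues h) :
    ∃ D ∈ wanderingDomains h, D ⊆ U := by
  obtain ⟨_, hD, q, rfl⟩ := hne
  -- These are the points whose whole fibre lies in `U`; compactness makes this set open, and the
  -- dense orbit of `q` enters it.
  have hV : IsOpen (h '' Uᶜ)ᶜ :=
    (hU.isClosed_compl.isCompact.image h.continuous).isClosed.isOpen_compl
  have hyV : h y ∈ (h '' Uᶜ)ᶜ := by
    rintro ⟨z, hz, hzy⟩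
    exact hfib ⟨y, rfl, z, hzy, fun hyz => hz (hyz ▸ hy)⟩
  obtain ⟨_, ⟨hr, k, rfl⟩⟩ := (hmin q).inter_open_nonempty _ hV ⟨_, hyV⟩
  refine ⟨_, ⟨nonempty_interior_fibre_add_zsmul hα hD k, _, rfl⟩, fun x hx => ?_⟩
  by_contra hxU
  exact hr ⟨x, hxU, interior_subset (s := h ⁻¹' {q + k • α}) hx⟩

/-- A connected open set that is not inside a wandering domain contains a point with trivial
fibre. -/
theorem exists_trivial_fibre_of_not_subset (hc : (nontrivialValues h).Countable)
    {S : Set (Torus n)} (hS : IsPreconnected S) (hSo : IsOpen S) (hSne : S.Nonempty)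
    (hnot : ∀ D ∈ wanderingDomains h, ¬ S ⊆ D) : ∃ y ∈ S, h y ∉ nontrivialValues h := by
  by_contra! hall
  obtain ⟨x, hx⟩ := hSne
  -- A connected subset of a countable set is a point, so `h` would be constant on `S`.
  have hsub : (h '' S).Subsingleton := hc.isTotallyDisconnected _
    (Set.image_subset_iff.2 hall) (hS.image h h.continuous.continuousOn)
  have hSint : S ⊆ interior (h ⁻¹' {h x}) := interior_maximal
    (fun y hy => hsub (Set.mem_image_of_mem h hy) (Set.mem_image_of_mem h hx)) hSo
  exact hnot _ ⟨⟨x, hSint hx⟩, _, rfl⟩ hSint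

/-- A finite dense orbit would exhaust the torus, and a finite connected torus is a point. This
keeps the fibres along an orbit distinct. -/
theorem IsMinimalTranslation.not_isOfFinAddOrder [Nontrivial (Torus n)]
    (hmin : IsMinimalTranslation α) :
    ¬ IsOfFinAddOrder α := by
  intro hfin
  have hrange : (Set.range fun k : ℤ => (0 : Torus n) + k • α).Finite := by
    simpa only [zero_add, AddSubgroup.coe_zmultiples] using hfin.finite_zmultiples
  have huniv : (Set.univ : Set (Torus n)).Finite := by
    rw [← (hmin 0).closure_eq, hrange.isClosed.closure_eq]
    exact hrange
  have hconn : IsPreconnected (Set.univ : Set (Torus n)) := by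
    rw [← (torusProj_surjective n).range_eq]
    exact isPreconnected_range (continuous_torusProj n)
  exact not_subsingleton (Torus n)
    (Set.subsingleton_univ_iff.1 (huniv.countable.isTotallyDisconnected _ subset_rfl hconn))

end Wandering

/-! ### Small squares and the pointwise inequality -/

theorem injOn_torusProj_ball {n : ℕ} (x : Fin n → ℝ) {r : ℝ} (hr : r ≤ 1 / 2) :
    Set.InjOn (torusProj n) (Metric.ball x r) := by
  intro y hy z hz hyz
  ext i
  obtain ⟨m, hm⟩ := mem_intLattice_iff.1 (torusProj_eq_iff.1 hyz) i
  have hdist : |y i - z i| < 1 := by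
    have h1 := (dist_le_pi_dist y x i).trans_lt hy
    have h2 := (dist_le_pi_dist z x i).trans_lt hz
    rw [Real.dist_eq, abs_lt] at h1 h2
    rw [abs_lt]
    constructor <;> linarith [h1.1, h1.2, h2.1, h2.2]
  rw [← Pi.sub_apply, ← hm, ← Int.cast_abs] at hdist
  have hm0 : m = 0 := Int.abs_lt_one_iff.1 (by exact_mod_cast hdist)
  rw [hm0, Int.cast_zero, Pi.sub_apply] at hm
  linarith

/-- Squares that lift wandering domains accumulate at every point outside the lifts of the
wandering domains. -/
theorem exists_lifted_square_subset_ball {f : Torus 2 ≃ₜ Torus 2} {h : C(Torus 2, Torus 2)}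
    {α : Torus 2} (hα : ∀ x, h (f x) = h x + α) (hmin : IsMinimalTranslation α)
    (hc : (nontrivialValues h).Countable) (hne : (wanderingDomains h).Nonempty)
    (hsq : ∀ D ∈ wanderingDomains h, IsSquareDomain D) {x : Fin 2 → ℝ}
    (hx : ∀ D ∈ wanderingDomains h, torusProj 2 x ∉ D) {r : ℝ} (hr : 0 < r) :
    ∃ D ∈ wanderingDomains h, ∃ a s, 0 < s ∧ Set.BijOn (torusProj 2) (openSquare a s) D ∧
      openSquare a s ⊆ Metric.ball x r := by
  -- Radius at most 1/2 makes the projection injective on `B`, so a domain inside its image lifts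
  -- into `B`.
  set B := Metric.ball x (min r (1 / 2)) with hB
  have hxB : x ∈ B := Metric.mem_ball_self (by positivity)
  have hSo : IsOpen (torusProj 2 '' B) := isOpenMap_torusProj 2 _ Metric.isOpen_ball
  obtain ⟨y, hy, hfib⟩ := exists_trivial_fibre_of_not_subset hc
    ((convex_ball x _).isPreconnected.image _ (continuous_torusProj 2).continuousOn) hSo
    ⟨_, x, hxB, rfl⟩ fun D hD hsub => hx D hD (hsub ⟨x, hxB, rfl⟩)
  obtain ⟨D, hD, hDS⟩ := exists_wanderingDomain_subset hα hmin hne hSo hy hfib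
  obtain ⟨a, s, hs, hbij⟩ := hsq D hD
  obtain ⟨k, hk⟩ := exists_subset_lattice_vadd (convex_openSquare a s).isPreconnected
    (nonempty_openSquare a hs) Metric.isOpen_ball (injOn_torusProj_ball x (min_le_right r _))
    (by rwa [hbij.image_eq])
  refine ⟨D, hD, -k +ᵥ a, s, hs, ?_, ?_⟩
  · rw [← lattice_vadd_openSquare]
    exact bijOn_torusProj_lattice_vadd hbij (-k)
  · rw [← lattice_vadd_openSquare]
    refine subset_trans ?_ (Metric.ball_subset_ball (min_le_left r (1 / 2)))
    rintro _ ⟨z, hz, rfl⟩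
    obtain ⟨w, hw, rfl⟩ := hk hz
    simpa using hw

open MeasureTheory in
-- On the squares, the mean of `u` is at most s'/s in absolute value and the mean of `J` is at least
-- (s'/s)². Both means tend to the values at `x` as the squares shrink.
theorem sq_le_of_openSquare_estimates {u J : (Fin 2 → ℝ) → ℝ} (hu : Continuous u)
    (hJ : Continuous J) {x : Fin 2 → ℝ} (hJx : 0 ≤ J x)
    (hest : ∀ r > 0, ∃ a s s', 0 < s ∧ 0 ≤ s' ∧ openSquare a s ⊆ Metric.ball x r ∧
      |∫ y in openSquare a s, u y| ≤ s * s' ∧ s' ^ 2 ≤ ∫ y in openSquare a s, J y) :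
    u x ^ 2 ≤ J x := by
  by_contra! hlt
  obtain ⟨ε, hε, hεu, hεJ⟩ : ∃ ε > 0, ε < |u x| ∧ J x + ε < (|u x| - ε) ^ 2 := by
    have hpos : 0 < |u x| := abs_pos.2 fun h0 => by
      rw [h0] at hlt
      linarith
    have hlt0 : J x + 0 < (|u x| - 0) ^ 2 := by simpa using hlt
    have h1 : ∀ᶠ ε in nhds (0 : ℝ), J x + ε < (|u x| - ε) ^ 2 :=
      Filter.Tendsto.eventually_lt (Continuous.tendsto (by fun_prop) 0)
        (Continuous.tendsto (by fun_prop) 0) hlt0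
    obtain ⟨ε, ⟨hε1, hε2⟩, hε⟩ := (((h1.and (eventually_lt_nhds hpos)).filter_mono
      nhdsWithin_le_nhds).and (self_mem_nhdsWithin (s := Set.Ioi 0))).exists
    exact ⟨ε, hε, hε2, hε1⟩
  obtain ⟨r, hr, hball⟩ := Metric.eventually_nhds_iff_ball.1
    ((Metric.tendsto_nhds.1 (hu.tendsto x) ε hε).and (Metric.tendsto_nhds.1 (hJ.tendsto x) ε hε))
  obtain ⟨a, s, s', hs, hs', hsub, hle, hge⟩ := hest r hr
  have hvol := volume_openSquare a hs.le
  have hfin : volume (openSquare a s) < ⊤ :=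
    (measure_mono (hsub.trans Metric.ball_subset_closedBall)).trans_lt
      (isCompact_closedBall x r).measure_lt_top
  have hint : ∀ {g : (Fin 2 → ℝ) → ℝ}, Continuous g → IntegrableOn g (openSquare a s) :=
    fun hg => (hg.continuousOn.integrableOn_compact (isCompact_closedBall x r)).mono_set
      (hsub.trans Metric.ball_subset_closedBall)
  have hest : ∀ {g : (Fin 2 → ℝ) → ℝ}, Continuous g →
      (∀ y ∈ Metric.ball x r, dist (g y) (g x) < ε) →
      |(∫ y in openSquare a s, g y) - g x * s ^ 2| ≤ ε * s ^ 2 := by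
    intro g hg hgε
    have h := norm_setIntegral_le_of_norm_le_const (f := fun y => g y - g x) hfin
      fun y hy => (hgε y (hsub hy)).le
    rw [integral_sub (hint hg) (hint continuous_const), setIntegral_const, hvol, smul_eq_mul,
      mul_comm (s ^ 2)] at h
    exact h
  have hu' := abs_le.1 (hest hu fun y hy => (hball y hy).1)
  have hJ' := abs_le.1 (hest hJ fun y hy => (hball y hy).2)
  have hule : |u x| * s ^ 2 ≤ s * s' + ε * s ^ 2 := by
    have hle' := abs_le.1 hle
    rw [← abs_of_pos (pow_pos hs 2), ← abs_mul, abs_of_pos (pow_pos hs 2), abs_le]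
    constructor <;> linarith [hu'.1, hu'.2, hle'.1, hle'.2]
  have h1 : (|u x| - ε) * s ≤ s' := by
    refine le_of_mul_le_mul_left ?_ hs
    linarith
  have h2 : ((|u x| - ε) * s) ^ 2 ≤ s' ^ 2 :=
    pow_le_pow_left₀ (mul_nonneg (by linarith) hs.le) h1 2
  have h3 : (J x + ε) * s ^ 2 < (|u x| - ε) ^ 2 * s ^ 2 :=
    mul_lt_mul_of_pos_right hεJ (pow_pos hs 2)
  rw [mul_pow] at h2
  linarith [hJ'.2]

/-! ### Integral estimates for the lift -/

namespace IsC1InjectiveLift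

variable {f : Torus 2 ≃ₜ Torus 2} {F : (Fin 2 → ℝ) → (Fin 2 → ℝ)}

theorem abs_setIntegral_fderiv_le (hF : IsC1InjectiveLift f F) (i : Fin 2) {a b : Fin 2 → ℝ}
    {s s' : ℝ} (hs : 0 < s) (himg : F '' openSquare a s = openSquare b s') :
    |∫ x in openSquare a s, fderiv ℝ F x (Pi.single 0 1) i| ≤ s * s' := by
  simp_rw [← hF.fderiv_apply]
  refine abs_setIntegral_openSquare_fderiv_le (contDiff_pi.1 hF.contDiff i) hs fun x hx y hy => ?_
  have hx' := (himg ▸ Set.mem_image_of_mem F hx : F x ∈ openSquare b s') i trivial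
  have hy' := (himg ▸ Set.mem_image_of_mem F hy : F y ∈ openSquare b s') i trivial
  rw [abs_le]
  constructor <;> linarith [hx'.1, hx'.2, hy'.1, hy'.2]

theorem setIntegral_openSquare_abs_det (hF : IsC1InjectiveLift f F) {a b : Fin 2 → ℝ}
    {s s' : ℝ} (hs' : 0 ≤ s') (himg : F '' openSquare a s = openSquare b s') :
    ∫ x in openSquare a s, |(fderiv ℝ F x).det| = s' ^ 2 := by
  rw [hF.setIntegral_abs_det (isOpen_openSquare a s).measurableSet, himg, volume_openSquare b hs']

theorem continuous_fderiv_apply (hF : IsC1InjectiveLift f F) (i : Fin 2) :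
    Continuous fun x => fderiv ℝ F x (Pi.single 0 1) i :=
  (continuous_apply i).comp
    ((hF.contDiff.continuous_fderiv one_ne_zero).clm_apply continuous_const)

/-- The lattice vector by which `F` shifts under the first unit translation is non-zero by
injectivity. The integral is one of its coordinates, hence an integer, and some coordinate is
non-zero. -/
theorem exists_one_le_abs_setIntegral_unitCube (hF : IsC1InjectiveLift f F) :
    ∃ i, 1 ≤ |∫ x in unitCube 2, fderiv ℝ F x (Pi.single 0 1) i| := by
  let k : intLattice 2 := ⟨Pi.single 0 1, mem_intLattice_iff.2 fun i => by
    by_cases hi : i = 0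
    · exact ⟨1, by simp [hi]⟩
    · exact ⟨0, by simp [hi]⟩⟩
  obtain ⟨m, hm⟩ := hF.exists_vadd k
  have hm0 : (m : Fin 2 → ℝ) ≠ 0 := fun h0 => by
    have h1 : F (k +ᵥ (0 : Fin 2 → ℝ)) = F 0 := by
      rw [hm, Submodule.vadd_def, h0, vadd_eq_add, zero_add]
    have h2 := congrFun (hF.injective h1) 0
    simp [k, Submodule.vadd_def] at h2
  obtain ⟨i, hi⟩ := Function.ne_iff.1 hm0
  refine ⟨i, ?_⟩
  simp_rw [← hF.fderiv_apply]
  rw [setIntegral_unitCube_fderiv (contDiff_pi.1 hF.contDiff i) (m := (m : Fin 2 → ℝ) i)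
    fun x => congrFun (hm x) i]
  obtain ⟨l, hl⟩ := mem_intLattice_iff.1 m.2 i
  rw [← hl, Pi.zero_apply] at hi
  rw [← hl]
  rw [← Int.cast_abs]
  exact_mod_cast Int.one_le_abs (by exact_mod_cast hi)

end IsC1InjectiveLift

/-! ### Preservation of area -/

theorem measureReal_unitCube_inter_preimage {D : Set (Torus 2)} {a : Fin 2 → ℝ} {s : ℝ}
    (hs : 0 ≤ s) (hD : Set.BijOn (torusProj 2) (openSquare a s) D) :
    MeasureTheory.volume.real (unitCube 2 ∩ torusProj 2 ⁻¹' D) = s ^ 2 := by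
  have h := setIntegral_unitCube_inter_preimage (isOpen_openSquare a s) hD (w := fun _ => 1)
    fun _ _ => rfl
  simpa [volume_openSquare a hs] using h

open MeasureTheory in
/-- A `C¹` diffeomorphism with square wandering domains preserves their area. -/
theorem measureReal_image_wanderingDomain {f : Torus 2 ≃ₜ Torus 2} {h : C(Torus 2, Torus 2)}
    {α : Torus 2} (hf : IsC1TorusDiffeo f) (hα : ∀ x, h (f x) = h x + α)
    (hmin : IsMinimalTranslation α) (hc : (nontrivialValues h).Countable)
    (hsq : ∀ D ∈ wanderingDomains h, IsSquareDomain D) {D₀ : Set (Torus 2)}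
    (hD₀ : D₀ ∈ wanderingDomains h) :
    volume.real (unitCube 2 ∩ torusProj 2 ⁻¹' (f '' D₀)) =
      volume.real (unitCube 2 ∩ torusProj 2 ⁻¹' D₀) := by
  obtain ⟨F, hF⟩ := hf.exists_lift
  obtain ⟨i, hi⟩ := hF.exists_one_le_abs_setIntegral_unitCube
  set u := fun x => fderiv ℝ F x (Pi.single 0 1) i with hu
  set J := fun x => |(fderiv ℝ F x).det| with hJ
  have hucont : Continuous u := hF.continuous_fderiv_apply i
  have hJcont : Continuous J := hF.continuous_abs_det
  have hsquare : ∀ D ∈ wanderingDomains h, ∀ a s, 0 < s →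
      Set.BijOn (torusProj 2) (openSquare a s) D → ∃ b s', 0 < s' ∧
        Set.BijOn (torusProj 2) (openSquare b s') (f '' D) ∧
        |∫ x in openSquare a s, u x| ≤ s * s' ∧ ∫ x in openSquare a s, J x = s' ^ 2 := by
    intro D hD a s hs hbij
    obtain ⟨b, s', hs', hbij'⟩ := hsq _ (image_mem_wanderingDomains hα hD)
    obtain ⟨c, himg⟩ := hF.image_openSquare hs hbij hbij'
    exact ⟨b, s', hs', hbij', hF.abs_setIntegral_fderiv_le i hs himg,
      hF.setIntegral_openSquare_abs_det hs'.le himg⟩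
  have hoff : ∀ x, (∀ D ∈ wanderingDomains h, torusProj 2 x ∉ D) → u x ^ 2 ≤ J x := by
    refine fun x hx => sq_le_of_openSquare_estimates hucont hJcont (abs_nonneg _) fun r hr => ?_
    obtain ⟨D, hD, a, s, hs, hbij, hsub⟩ :=
      exists_lifted_square_subset_ball hα hmin hc ⟨D₀, hD₀⟩ hsq hx hr
    obtain ⟨b, s', hs', -, hle, heq⟩ := hsquare D hD a s hs hbij
    exact ⟨a, s, s', hs, hs'.le, hsub, hle, heq.ge⟩
  obtain ⟨σ, hσ, hσu⟩ : ∃ σ : ℝ, |σ| = 1 ∧ 1 ≤ σ * ∫ x in unitCube 2, u x := by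
    rcases le_abs'.1 hi with hneg | hpos
    · exact ⟨-1, by simp, by linarith⟩
    · exact ⟨1, by simp, by linarith⟩
  -- On a square, the three terms turn the estimates into s² + s'² - 2ss', a perfect square.
  set w := fun x => 1 + J x - 2 * (σ * u x) with hw
  have hwcont : Continuous w := by fun_prop
  have hCcube : unitCube 2 ⊆ Set.Icc 0 1 := by
    rw [unitCube, ZSpan.fundamentalDomain_pi_basisFun, ← Set.pi_univ_Icc]
    exact Set.pi_mono fun _ _ => Set.Ico_subset_Icc_self
  have hC : MeasurableSet (unitCube 2) := ZSpan.fundamentalDomain_measurableSet _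
  have hCint : ∀ {g : (Fin 2 → ℝ) → ℝ}, Continuous g → IntegrableOn g (unitCube 2) :=
    fun hg => (hg.continuousOn.integrableOn_compact isCompact_Icc).mono_set hCcube
  have hsplit : ∀ A : Set (Fin 2 → ℝ), (∀ {g : (Fin 2 → ℝ) → ℝ}, Continuous g →
      IntegrableOn g A) → ∫ x in A, w x =
        volume.real A + (∫ x in A, J x) - 2 * (σ * ∫ x in A, u x) := by
    intro A hA
    rw [hw, integral_sub (hA (by fun_prop)) (hA (by fun_prop)),
      integral_add (hA (by fun_prop)) (hA hJcont), integral_const_mul, integral_const_mul]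
    simp
  have hwC : ∫ x in unitCube 2, w x ≤ 0 := by
    have hvol : volume.real (unitCube 2) = 1 := by
      simp [measureReal_def, ZSpan.fundamentalDomain_pi_basisFun, Real.volume_pi_Ico]
    rw [hsplit _ hCint, hvol]
    linarith [hF.setIntegral_unitCube_abs_det_le]
  have hwoff : ∀ x, (∀ D ∈ wanderingDomains h, torusProj 2 x ∉ D) → 0 ≤ w x := by
    intro x hx
    have h1 := hoff x hx
    have h2 : σ ^ 2 = 1 := by rw [← sq_abs, hσ, one_pow]
    simp only [hw]
    -- Since `J x` ≥ `u x`² and σ² = 1, the weight dominates (1 - σu)².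
    nlinarith [sq_nonneg (1 - σ * u x)]
  have hwD : ∀ D ∈ wanderingDomains h, ∀ a s, 0 < s →
      Set.BijOn (torusProj 2) (openSquare a s) D → ∃ b s', 0 < s' ∧
        Set.BijOn (torusProj 2) (openSquare b s') (f '' D) ∧
        (s - s') ^ 2 ≤ ∫ x in unitCube 2 ∩ torusProj 2 ⁻¹' D, w x := by
    intro D hD a s hs hbij
    obtain ⟨b, s', hs', hbij', hle, heq⟩ := hsquare D hD a s hs hbij
    refine ⟨b, s', hs', hbij', ?_⟩
    rw [setIntegral_unitCube_inter_preimage (isOpen_openSquare a s) hbij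
      fun k x => by simp only [hw, hu, hJ, hF.fderiv_vadd],
      hsplit _ fun hg => (hg.continuousOn.integrableOn_compact isCompact_Icc).mono_set
        (subset_closure.trans (closure_openSquare a hs).subset), heq, volume_openSquare a hs.le]
    have h1 : σ * ∫ x in openSquare a s, u x ≤ s * s' := by
      refine (le_abs_self _).trans ?_
      rwa [abs_mul, hσ, one_mul]
    nlinarith
  have hmeas : ∀ D : wanderingDomains h, MeasurableSet (torusProj 2 ⁻¹' (D : Set (Torus 2))) :=
    fun D => ((isOpen_of_mem_wanderingDomains D.2).preimage (continuous_torusProj 2)).measurableSet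
  have hdisj : Pairwise (Function.onFun Disjoint
      fun D : wanderingDomains h => unitCube 2 ∩ torusProj 2 ⁻¹' (D : Set (Torus 2))) :=
    fun D E hDE => (Disjoint.preimage _ (pairwiseDisjoint_wanderingDomains h D.2 E.2
      (Subtype.coe_injective.ne hDE))).mono Set.inter_subset_right Set.inter_subset_right
  have : Countable (wanderingDomains h) :=
    ((pairwiseDisjoint_wanderingDomains h).countable_of_isOpen
      (fun D hD => isOpen_of_mem_wanderingDomains hD) fun D hD => hD.1).to_subtype
  have hsum := hasSum_integral_iUnion (f := w) (fun D => hC.inter (hmeas D)) hdisj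
    ((hCint hwcont).mono_set (Set.iUnion_subset fun D => Set.inter_subset_left))
  have hterm : ∀ D : wanderingDomains h,
      0 ≤ ∫ x in unitCube 2 ∩ torusProj 2 ⁻¹' (D : Set (Torus 2)), w x := fun D => by
    obtain ⟨a, s, hs, hbij⟩ := hsq D D.2
    obtain ⟨-, s', -, -, hle⟩ := hwD D D.2 a s hs hbij
    exact (sq_nonneg _).trans hle
  have hle₀ := le_hasSum hsum ⟨D₀, hD₀⟩ fun D _ => hterm D
  rw [← Set.inter_iUnion] at hle₀
  have hdecomp := integral_inter_add_sdiff (MeasurableSet.iUnion hmeas) (hCint hwcont)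
  have hrest : 0 ≤ ∫ x in unitCube 2 \ ⋃ D : wanderingDomains h,
      torusProj 2 ⁻¹' (D : Set (Torus 2)), w x :=
    setIntegral_nonneg (hC.diff (MeasurableSet.iUnion hmeas)) fun x hx =>
      hwoff x fun D hD hxD => hx.2 (Set.mem_iUnion.2 ⟨⟨D, hD⟩, hxD⟩)
  obtain ⟨a, s, hs, hbij⟩ := hsq D₀ hD₀
  obtain ⟨b, s', hs', hbij', hle⟩ := hwD D₀ hD₀ a s hs hbij
  -- The total integral is at most 0, while the rest of the cube and all the other domains
  -- contribute at least 0; nothing positive is left for `D₀`.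
  have hss : (s - s') ^ 2 = 0 := le_antisymm (by linarith) (sq_nonneg _)
  rw [measureReal_unitCube_inter_preimage hs.le hbij,
    measureReal_unitCube_inter_preimage hs'.le hbij',
    sub_eq_zero.1 (eq_zero_of_pow_eq_zero hss)]

/-! ### Contradiction with finite area -/

theorem propositionP :
    ¬ ∃ (f : Torus 2 ≃ₜ Torus 2) (h : C(Torus 2, Torus 2)),
      IsC1TorusDiffeo f ∧ IsDenjoyTypeVia f h ∧
        (wanderingDomains h).Nonempty ∧ ∀ D ∈ wanderingDomains h, IsSquareDomain D := by
  rintro ⟨f, h, hf, hD, ⟨_, hne, p, rfl⟩, hsq⟩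
  obtain ⟨-, ⟨-, ⟨q, hq⟩, hc, α, hmin, hα⟩, -⟩ := hD
  obtain ⟨y, -, z, -, hyz⟩ := hq
  have : Nontrivial (Torus 2) := ⟨y, z, hyz⟩
  set D : ℕ → Set (Torus 2) := fun k => interior (h ⁻¹' {p + k • α}) with hDdef
  have hDmem : ∀ k, D k ∈ wanderingDomains h := fun k => by
    have hk := nonempty_interior_fibre_add_zsmul hα hne (k : ℤ)
    rw [natCast_zsmul] at hk
    exact ⟨hk, _, rfl⟩
  have hDsucc : ∀ k, f '' D k = D (k + 1) := fun k => by
    simp only [hDdef]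
    rw [image_interior_fibre_of_semiconj hα, succ_nsmul, add_assoc]
  set A : ℕ → Set (Fin 2 → ℝ) := fun k => unitCube 2 ∩ torusProj 2 ⁻¹' D k with hA
  have hvol : ∀ k, MeasureTheory.volume.real (A k) = MeasureTheory.volume.real (A 0) := fun k => by
    induction k with
    | zero => rfl
    | succ k ih =>
      rw [← ih]
      simp only [hA]
      rw [← hDsucc, measureReal_image_wanderingDomain hf hα hmin hc hsq (hDmem k)]
  have hpos : 0 < MeasureTheory.volume.real (A 0) := by
    obtain ⟨a, s, hs, hbij⟩ := hsq _ (hDmem 0)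
    simp only [hA]
    rw [measureReal_unitCube_inter_preimage hs.le hbij]
    positivity
  have hCfin : MeasureTheory.volume (unitCube 2) ≠ ⊤ := by
    simp [ZSpan.fundamentalDomain_pi_basisFun, Real.volume_pi_Ico]
  -- In a disjoint family inside the unit cube, only finitely many sets have area at least that of
  -- `A 0`; yet every `A k` does.
  have hfin := MeasureTheory.Measure.finite_const_le_meas_of_disjoint_iUnion
    MeasureTheory.volume (ENNReal.ofReal_pos.2 hpos) (As := A)
    (fun k => (ZSpan.fundamentalDomain_measurableSet _).inter
      ((isOpen_interior.preimage (continuous_torusProj 2)).measurableSet))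
    (fun k l hkl => by
      refine Disjoint.mono Set.inter_subset_right Set.inter_subset_right (Disjoint.preimage _ ?_)
      refine Disjoint.mono interior_subset interior_subset (Disjoint.preimage h ?_)
      rw [Set.disjoint_singleton, Ne, add_right_inj]
      exact (injective_nsmul_iff_not_isOfFinAddOrder.2 hmin.not_isOfFinAddOrder).ne hkl)
    (MeasureTheory.measure_ne_top_of_subset (Set.iUnion_subset fun k => Set.inter_subset_left)
      hCfin)
  refine Set.infinite_univ (hfin.subset fun k _ => ?_)
  rw [Set.mem_ofPred_eq, ← hvol k, MeasureTheory.ofReal_measureReal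
    (MeasureTheory.measure_ne_top_of_subset Set.inter_subset_left hCfin)]
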